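/- Let $d\in\mathbb{N}$, $T>0$, and write points of $\mathbb{R}^{d+1}$ as $(s,x)\in\mathbb{R}\times\mathbb{R}^d$. Let $K:\mathbb{R}^{d+1}\to\mathbb{R}$, and let $\widehat K(z)=(2\pi)^{-(d+1)/2}\int_{\mathbb{R}^{d+1}}e^{-iz^{\mathsf T}\xi}K(\xi)\,d\xi$ denote its Fourier transform. Assume: (A1) $K$ is continuous and integrable, it is positive definite (that is, $K(-\xi)=K(\xi)$ and $\sum_{i,j}c_ic_jK(\xi_i-\xi_j)\ge 0$ for all finite families of points $\xi_i\in\mathbb{R}^{d+1}$ and coefficients $c_i\in\mathbb{R}$), and $\mathrm{supp}\,\widehat K=\mathbb{R}^{d+1}$. (A2) $\int_{\mathbb{R}^{d+1}}(1+|z|^2)\,\widehat K(z)\,dz<\infty$ (absolutely convergent). (A3) $p\in C([0,T];L^1(\mathbb{R}^d))\cap L^\infty([0,T]\times\mathbb{R}^d)$, each $p(t,\cdot)$, $t\in[0,T]$, is a probability density on $\mathbb{R}^d$, and the weak derivative $\partial_tp$ exists and belongs to $L^1((0,T)\times\mathbb{R}^d)$. Let $\mathcal{H}$ be the reproducing kernel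 Hilbert space of functions on $\mathbb{R}^{d+1}$ with kernel $(\xi,\eta)\mapsto K(\xi-\eta)$. Let $\mathcal{U}$ be the set of $u\in L^1([0,T]\times\mathbb{R}^d;\mathbb{R}^d,\,p(t,x)\,dt\,dx)$ such that the weak divergence $\mathrm{div}_x(pu)$ exists and belongs to $L^1((0,T)\times\mathbb{R}^d)$. Let $C_0^\infty([0,T]\times\mathbb{R}^d)$ be the set of restrictions to $[0,T]\times\mathbb{R}^d$ of smooth compactly supported functions on $\mathbb{R}\times\mathbb{R}^d$. For $u\in\mathcal{U}$, $t\in[0,T]$ and a test function $\varphi$, consider the weak continuity equation $$\int_0^t\!\int_{\mathbb{R}^d}p(s,x)\bigl(\partial_s\varphi(s,x)+u(s,x)^{\mathsf T}\nabla_x\varphi(s,x)\bigr)\,dx\,ds=\int_{\mathbb{R}^d}p(t,x)\varphi(t,x)\,dx-\int_{\mathbb{R}^d}p(0,x)\varphi(0,x)\,dx.\qquad(*)$$ Then, for every $u\in\mathcal{U}$ and every $t\in[0,T]$, all terms of $(*)$ are well defined for every $\varphi\in C_0^\infty([0,T]\times\mathbb{R}^d)$ and for every $\varphi\in\mathcal{H}$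 (such $\varphi$ are $C^1$ and the integrals converge absolutely), and $(*)$ holds for all $\varphi\in C_0^\infty([0,T]\times\mathbb{R}^d)$ if and only if it holds for all $\varphi\in\mathcal{H}$. -/

import Mathlib

open MeasureTheory Set Filter Topology
open scoped ContDiff ENNReal

noncomputable section

namespace WeakContinuity

/-- The space `ℝ^d` with its Euclidean norm. -/
abbrev Space (d : ℕ) : Type := EuclideanSpace ℝ (Fin d)

/-- Space-time `ℝ^{d+1} = ℝ × ℝ^d`, with points `(s, x)` and Lebesgue (product) measure. -/
abbrev SpaceTime (d : ℕ) : Type := ℝ × Space d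

/-- The partial derivative `∂_s φ (s, x)`. -/
def timeDeriv {d : ℕ} (φ : SpaceTime d → ℝ) (z : SpaceTime d) : ℝ :=
  deriv (fun s : ℝ => φ (s, z.2)) z.1

/-- The spatial gradient `∇_x φ (s, x)`. -/
def spaceGrad {d : ℕ} (φ : SpaceTime d → ℝ) (z : SpaceTime d) : Space d :=
  gradient (fun x : Space d => φ (z.1, x)) z.2

/-- The operator `𝒜^u φ = ∂_s φ + u ⬝ ∇_x φ`. -/
def transport {d : ℕ} (u : SpaceTime d → Space d) (φ : SpaceTime d → ℝ) (z : SpaceTime d) : ℝ :=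
  timeDeriv φ z + inner ℝ (u z) (spaceGrad φ z)

/-- The closed slab `[0, t] × ℝ^d`. -/
def slab (d : ℕ) (t : ℝ) : Set (SpaceTime d) := Icc 0 t ×ˢ univ

/-- The open slab `(0, t) × ℝ^d`. -/
def openSlab (d : ℕ) (t : ℝ) : Set (SpaceTime d) := Ioo 0 t ×ˢ univ

/-- Smooth, compactly supported test functions in the open slab `(0, T) × ℝ^d`. -/
structure IsInteriorTest {d : ℕ} (T : ℝ) (φ : SpaceTime d → ℝ) : Prop where
  smooth : ContDiff ℝ ∞ φ
  compactSupport : HasCompactSupport φ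
  support_subset : tsupport φ ⊆ openSlab d T

/-- The class `C_0^∞([0,T] × ℝ^d)`: its elements are the restrictions to the slab of the smooth
compactly supported functions on `ℝ × ℝ^d`, so they need not vanish at the times `0` and `T`. -/
structure IsTest {d : ℕ} (φ : SpaceTime d → ℝ) : Prop where
  smooth : ContDiff ℝ ∞ φ
  compactSupport : HasCompactSupport φ

/-- `q` is the weak time derivative of `p` on `(0, T) × ℝ^d`, and is integrable there. -/
structure IsWeakTimeDeriv {d : ℕ} (T : ℝ) (p q : SpaceTime d → ℝ) : Prop where
  integrable : IntegrableOn q (openSlab d T)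
  integral_eq : ∀ φ : SpaceTime d → ℝ, IsInteriorTest T φ →
    ∫ z in openSlab d T, p z * timeDeriv φ z = -∫ z in openSlab d T, q z * φ z

/-- `g` is the weak spatial divergence of the vector field `w` on `(0, T) × ℝ^d`, and is
integrable there. -/
structure IsWeakDiv {d : ℕ} (T : ℝ) (w : SpaceTime d → Space d) (g : SpaceTime d → ℝ) : Prop where
  integrable : IntegrableOn g (openSlab d T)
  integral_eq : ∀ φ : SpaceTime d → ℝ, IsInteriorTest T φ →
    ∫ z in openSlab d T, inner ℝ (w z) (spaceGrad φ z) = -∫ z in openSlab d T, g z * φ z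

/-- The Fourier transform
`K̂(τ, ζ) = (2π)^{-(d+1)/2} ∫ exp(-i (τ s + ζ ⬝ x)) K(s, x) d(s, x)`. -/
def fourierTransform {d : ℕ} (K : SpaceTime d → ℝ) (z : SpaceTime d) : ℂ :=
  (((2 * Real.pi) ^ (-((d : ℝ) + 1) / 2) : ℝ) : ℂ) *
    ∫ ξ : SpaceTime d,
      Complex.exp (-(Complex.I * ((z.1 * ξ.1 + inner ℝ z.2 ξ.2 : ℝ) : ℂ))) * (K ξ : ℂ)

/-- The translation-invariant kernel `(ξ, η) ↦ K(ξ - η)`, as a matrix of operators `ℝ → ℝ`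
(multiplication by the scalar `K(ξ - η)`). -/
def kernelMatrix {d : ℕ} (K : SpaceTime d → ℝ) : Matrix (SpaceTime d) (SpaceTime d) (ℝ →L[ℝ] ℝ) :=
  Matrix.of fun ξ η => K (ξ - η) • ContinuousLinearMap.id ℝ ℝ

/-- `K` is a positive definite function: the kernel `K(ξ - η)` is symmetric and
`∑ᵢⱼ cᵢ cⱼ K(ξᵢ - ξⱼ) ≥ 0` for all finite families of points and real coefficients. -/
structure IsPosDefKernel {d : ℕ} (K : SpaceTime d → ℝ) : Prop where
  symm : ∀ ξ, K (-ξ) = K ξ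
  nonneg : ∀ c : SpaceTime d →₀ ℝ,
    0 ≤ c.sum fun ξ a => c.sum fun η b => a * b * K (ξ - η)

theorem IsPosDefKernel.posSemidef {d : ℕ} {K : SpaceTime d → ℝ} (hK : IsPosDefKernel K) :
    (kernelMatrix K).PosSemidef := by
  have hherm : (kernelMatrix K).IsHermitian := by
    refine Matrix.IsHermitian.ext fun ξ η => ?_
    have h := hK.symm (ξ - η)
    rw [neg_sub] at h
    have h1 : star (ContinuousLinearMap.id ℝ ℝ) = ContinuousLinearMap.id ℝ ℝ :=
      star_one (ℝ →L[ℝ] ℝ)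
    simp [kernelMatrix, h, h1]
  have h3 : ∀ c : SpaceTime d →₀ ℝ, 0 ≤ RCLike.re
      (c.sum fun ξ a => c.sum fun η b => inner ℝ (kernelMatrix K η ξ a) b) := by
    intro c
    refine (hK.nonneg c).trans_eq ?_
    simp only [Finsupp.sum, RCLike.re_to_real]
    rw [Finset.sum_comm]
    refine Finset.sum_congr rfl fun ξ _ => Finset.sum_congr rfl fun η _ => ?_
    simp [kernelMatrix]
    ring
  have htfae := RKHS.posSemidef_tfae (𝕜 := ℝ) (K := kernelMatrix K)
  exact ((htfae.out 0 2 :) : (kernelMatrix K).PosSemidef ↔ _).mpr ⟨hherm, h3⟩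

/-- The reproducing kernel Hilbert space of the kernel `K(ξ - η)`, as a set of functions on
`ℝ × ℝ^d`. -/
def rkhs {d : ℕ} (K : SpaceTime d → ℝ) (hK : IsPosDefKernel K) : Set (SpaceTime d → ℝ) :=
  haveI : Fact (kernelMatrix K).PosSemidef := ⟨hK.posSemidef⟩
  range fun f : RKHS.OfKernel (kernelMatrix K) => (f : SpaceTime d → ℝ)

/-- Assumption on the kernel: `K` is continuous, integrable and positive definite, and its Fourier
transform has full support. -/
structure KernelAssumption {d : ℕ} (K : SpaceTime d → ℝ) : Prop where
  continuous : Continuous K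
  integrable : Integrable K
  posDef : IsPosDefKernel K
  fullSupport : tsupport (fourierTransform K) = univ

/-- The second moment of the Fourier transform is finite: `∫ (1 + |z|²) K̂(z) dz < ∞`. -/
def KernelMoment {d : ℕ} (K : SpaceTime d → ℝ) : Prop :=
  Integrable fun z : SpaceTime d => (1 + (z.1 ^ 2 + ‖z.2‖ ^ 2)) • fourierTransform K z

/-- Assumption on the marginal flow: `p ∈ C([0,T]; L¹(ℝ^d)) ∩ L^∞([0,T] × ℝ^d)`, each `p(t, ·)` is
a probability density, and `∂_t p ∈ L¹((0,T) × ℝ^d)` in the weak sense. -/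
structure FlowAssumption {d : ℕ} (T : ℝ) (p : SpaceTime d → ℝ) : Prop where
  integrable : ∀ t ∈ Icc 0 T, Integrable fun x => p (t, x)
  continuous : ∀ t ∈ Icc 0 T,
    Tendsto (fun s => ∫ x, |p (s, x) - p (t, x)|) (𝓝[Icc 0 T] t) (𝓝 0)
  bounded : MemLp p ∞ (volume.restrict (slab d T))
  nonneg : ∀ t ∈ Icc 0 T, ∀ᵐ x, 0 ≤ p (t, x)
  integral_eq_one : ∀ t ∈ Icc 0 T, ∫ x, p (t, x) = 1
  timeDeriv : ∃ q : SpaceTime d → ℝ, IsWeakTimeDeriv T p q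

/-- The class `𝒰` of velocity fields `u ∈ L¹([0,T] × ℝ^d; ℝ^d, p dt dx)` for which
`div_x (p u) ∈ L¹((0,T) × ℝ^d)` in the weak sense. -/
structure IsVelocity {d : ℕ} (T : ℝ) (p : SpaceTime d → ℝ) (u : SpaceTime d → Space d) : Prop where
  integrable : Integrable u
    ((volume.restrict (slab d T)).withDensity fun z => ENNReal.ofReal (p z))
  weakDiv : ∃ g : SpaceTime d → ℝ, IsWeakDiv T (fun z => p z • u z) g

/-- The weak continuity equation on `[0, t]` tested against `φ`. -/
def WeakEquation {d : ℕ} (p : SpaceTime d → ℝ) (u : SpaceTime d → Space d) (t : ℝ)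
    (φ : SpaceTime d → ℝ) : Prop :=
  ∫ s in (0 : ℝ)..t, ∫ x : Space d, p (s, x) * transport u φ (s, x) =
    (∫ x : Space d, p (t, x) * φ (t, x)) - ∫ x : Space d, p (0, x) * φ (0, x)

/-- All terms of the weak continuity equation on `[0, t]` tested against `φ` make sense: `φ` is
continuously differentiable, and the integrals converge absolutely. -/
structure WellDefined {d : ℕ} (p : SpaceTime d → ℝ) (u : SpaceTime d → Space d) (t : ℝ)
    (φ : SpaceTime d → ℝ) : Prop where
  contDiff : ContDiff ℝ 1 φ
  integrable_transport : IntegrableOn (fun z => p z * transport u φ z) (slab d t)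
  integrable_final : Integrable fun x : Space d => p (t, x) * φ (t, x)
  integrable_initial : Integrable fun x : Space d => p (0, x) * φ (0, x)

end WeakContinuity

end

/-!
The defect of the continuity equation, that is, the difference of its two sides, is linear in the
test function, and it is continuous along sequences of test functions that are bounded in `C¹` and
converge pointwise together with their derivatives (`tendsto_defect`). It makes sense for every
bounded `C¹` test function, complex-valued ones included, in particular for the plane waves
`ξ ↦ exp(i z ⬝ ξ)`. The idea is that either class of test functions makes the equation hold if and
only if the defect `ℓ(z)` of the plane wave of frequency `z` vanishes for every `z`.

If `φ = ∫ A(z) exp(i z ⬝ ξ) dz`, where `A` has a finite first moment, then by Fubini's theorem the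
defect of `φ` is `∫ A(z) ℓ(z) dz` (`IsSuperposition.defect_eq`). Fourier inversion puts into this
form the smooth compactly supported functions and, by the moment condition on `K̂`, the translates
of `K`. Hence `ℓ = 0` implies the equation for the former, and for the span of the latter.

The span is dense in the reproducing kernel Hilbert space, and convergence in that space is
convergence in `C¹` (`exists_seq_kernelSpan`): the second moment of `K̂` gives
`2 K(0) - 2 K(v) ≤ C² |v|²`, which is to say `‖K(· - x) - K(· - y)‖ ≤ C |x - y|`, so an element `f`
is Lipschitz with constant `C ‖f‖`. Therefore `ℓ = 0` implies the equation on the whole space.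

Conversely, plane waves are limits of test functions cut off at larger and larger radii
(`defect_wave_eq_zero_of_isTest`). For the Hilbert space, the defect of `K(· - η)` is up to a
constant the Fourier transform at `η` of `K̂ ℓ`; if it vanishes for all `η`, then `K̂ ℓ = 0`, and
since `K̂` has full support and `ℓ` is continuous, `ℓ = 0`
(`defect_wave_eq_zero_of_translates`).
-/

noncomputable section

namespace WeakContinuity

/-! ### The continuity equation as a functional of the test function -/

variable {d : ℕ} {F G : Type*} [NormedAddCommGroup F] [NormedSpace ℝ F]
  [NormedAddCommGroup G] [NormedSpace ℝ G]

/-- `φ` is continuously differentiable, and `C` bounds both `φ` and its derivative everywhere. -/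
structure HasC1Bound (φ : SpaceTime d → F) (C : ℝ) : Prop where
  contDiff : ContDiff ℝ 1 φ
  norm_le : ∀ z, ‖φ z‖ ≤ C
  norm_fderiv_le : ∀ z, ‖fderiv ℝ φ z‖ ≤ C

theorem HasC1Bound.clm_comp {φ : SpaceTime d → F} {C : ℝ} (h : HasC1Bound φ C) (T : F →L[ℝ] G) :
    HasC1Bound (fun z => T (φ z)) (‖T‖ * C) where
  contDiff := T.contDiff.comp h.contDiff
  norm_le z := (T.le_opNorm _).trans (by gcongr; exact h.norm_le z)
  norm_fderiv_le z := by
    have : fderiv ℝ (fun z => T (φ z)) z = T.comp (fderiv ℝ φ z) :=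
      (T.hasFDerivAt.comp z (h.contDiff.differentiable one_ne_zero z).hasFDerivAt).fderiv
    rw [this]
    exact (T.opNorm_comp_le _).trans (by gcongr; exact h.norm_fderiv_le z)

theorem IsTest.hasC1Bound {φ : SpaceTime d → ℝ} (h : IsTest φ) : ∃ C, HasC1Bound φ C := by
  have h1 : ContDiff ℝ 1 φ := h.smooth.of_le (by simp)
  obtain ⟨C₁, h₁⟩ := h.compactSupport.exists_bound_of_continuous h1.continuous
  obtain ⟨C₂, h₂⟩ := (h.compactSupport.fderiv ℝ).exists_bound_of_continuous
    (h1.continuous_fderiv one_ne_zero)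
  exact ⟨max C₁ C₂, h1, fun z => (h₁ z).trans (le_max_left _ _),
    fun z => (h₂ z).trans (le_max_right _ _)⟩

/-- The space-time current `(p, p u)`; the transport term of the continuity equation is the
derivative of the test function in this direction. -/
def current (p : SpaceTime d → ℝ) (u : SpaceTime d → Space d) (z : SpaceTime d) : SpaceTime d :=
  (p z, p z • u z)

/-- The integrability that the continuity equation on `[0, t]` needs: the current is integrable on
the slab, and the two marginals are integrable on `ℝ^d`. -/
structure IsAdmissible (p : SpaceTime d → ℝ) (u : SpaceTime d → Space d) (t : ℝ) : Prop where
  current : IntegrableOn (current p u) (slab d t)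
  final : Integrable fun x => p (t, x)
  initial : Integrable fun x => p (0, x)

/-- The difference of the two sides of the weak continuity equation. The test function may take
values in any normed space `F`, so that complex exponentials can be inserted. -/
def defect (p : SpaceTime d → ℝ) (u : SpaceTime d → Space d) (t : ℝ) (φ : SpaceTime d → F) : F :=
  (∫ z in slab d t, fderiv ℝ φ z (current p u z)) -
    ((∫ x, p (t, x) • φ (t, x)) - ∫ x, p (0, x) • φ (0, x))

section

variable {p : SpaceTime d → ℝ} {u : SpaceTime d → Space d} {t : ℝ}

theorem aestronglyMeasurable_fderiv_current {φ : SpaceTime d → F} (h : IsAdmissible p u t)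
    (hφ : ContDiff ℝ 1 φ) :
    AEStronglyMeasurable (fun z => fderiv ℝ φ z (current p u z))
      (volume.restrict (slab d t)) :=
  isBoundedBilinearMap_apply.continuous.comp_aestronglyMeasurable
    ((hφ.continuous_fderiv one_ne_zero).aestronglyMeasurable.prodMk h.current.1)

theorem HasC1Bound.integrableOn_fderiv {φ : SpaceTime d → F} {C : ℝ} (hφ : HasC1Bound φ C)
    (h : IsAdmissible p u t) :
    IntegrableOn (fun z => fderiv ℝ φ z (current p u z)) (slab d t) := by
  refine (h.current.norm.const_mul C).mono' (aestronglyMeasurable_fderiv_current h hφ.contDiff) ?_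
  refine Eventually.of_forall fun z => ((fderiv ℝ φ z).le_opNorm _).trans ?_
  gcongr
  exact hφ.norm_fderiv_le z

theorem HasC1Bound.integrable_smul {φ : SpaceTime d → F} {C : ℝ} (hφ : HasC1Bound φ C)
    {s : ℝ} {ρ : Space d → ℝ} (hρ : Integrable ρ) :
    Integrable fun x => ρ x • φ (s, x) := by
  refine (hρ.norm.mul_const C).mono' (hρ.1.smul
    (hφ.contDiff.continuous.comp (by fun_prop)).aestronglyMeasurable) ?_
  refine Eventually.of_forall fun x => ?_
  rw [norm_smul]
  gcongr
  exact hφ.norm_le _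

theorem defect_clm_comp [CompleteSpace F] [CompleteSpace G] {φ : SpaceTime d → F} {C : ℝ}
    (hφ : HasC1Bound φ C) (h : IsAdmissible p u t) (T : F →L[ℝ] G) :
    defect p u t (fun z => T (φ z)) = T (defect p u t φ) := by
  have hd : ∀ z, fderiv ℝ (fun z => T (φ z)) z = T.comp (fderiv ℝ φ z) := fun z =>
    (T.hasFDerivAt.comp z (hφ.contDiff.differentiable one_ne_zero z).hasFDerivAt).fderiv
  simp only [defect, hd, map_sub, ContinuousLinearMap.comp_apply, ← map_smul]
  rw [T.integral_comp_comm (hφ.integrableOn_fderiv h),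
    T.integral_comp_comm (hφ.integrable_smul h.final),
    T.integral_comp_comm (hφ.integrable_smul h.initial)]

/-- The defect is continuous under pointwise convergence of the test functions and of their
derivatives, as long as a common bound holds: this is dominated convergence. -/
theorem tendsto_defect {ι : Type*} {l : Filter ι} [l.IsCountablyGenerated]
    {φ : ι → SpaceTime d → F} {ψ : SpaceTime d → F} {C : ℝ} (h : IsAdmissible p u t)
    (hφ : ∀ᶠ i in l, HasC1Bound (φ i) C)
    (hlim : ∀ z, Tendsto (fun i => φ i z) l (𝓝 (ψ z)))
    (hlim' : ∀ z, Tendsto (fun i => fderiv ℝ (φ i) z) l (𝓝 (fderiv ℝ ψ z))) :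
    Tendsto (fun i => defect p u t (φ i)) l (𝓝 (defect p u t ψ)) := by
  refine Tendsto.sub ?_ (Tendsto.sub ?_ ?_)
  · refine tendsto_integral_filter_of_dominated_convergence (fun z => C * ‖current p u z‖)
      (hφ.mono fun i hi => aestronglyMeasurable_fderiv_current h hi.contDiff) ?_
      (h.current.norm.const_mul C)
      (Eventually.of_forall fun z =>
        ((ContinuousLinearMap.apply ℝ F (current p u z)).continuous.tendsto _).comp (hlim' z))
    refine hφ.mono fun i hi => Eventually.of_forall fun z =>
      (ContinuousLinearMap.le_opNorm _ _).trans ?_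
    gcongr
    exact hi.norm_fderiv_le z
  · refine tendsto_integral_filter_of_dominated_convergence (fun x => ‖p (t, x)‖ * C)
      (hφ.mono fun i hi => (hi.integrable_smul h.final).1) ?_ (h.final.norm.mul_const C)
      (Eventually.of_forall fun x => (hlim _).const_smul _)
    refine hφ.mono fun i hi => Eventually.of_forall fun x => ?_
    rw [norm_smul]
    gcongr
    exact hi.norm_le _
  · refine tendsto_integral_filter_of_dominated_convergence (fun x => ‖p (0, x)‖ * C)
      (hφ.mono fun i hi => (hi.integrable_smul h.initial).1) ?_ (h.initial.norm.mul_const C)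
      (Eventually.of_forall fun x => (hlim _).const_smul _)
    refine hφ.mono fun i hi => Eventually.of_forall fun x => ?_
    rw [norm_smul]
    gcongr
    exact hi.norm_le _

/-- Time derivative and spatial gradient combine into the Fréchet derivative on space-time. -/
theorem mul_transport_eq {φ : SpaceTime d → ℝ} {z : SpaceTime d} (hφ : DifferentiableAt ℝ φ z) :
    p z * transport u φ z = fderiv ℝ φ z (current p u z) := by
  have h1 : timeDeriv φ z = fderiv ℝ φ z (1, 0) := by
    have := hφ.hasFDerivAt.comp_hasDerivAt z.1
      ((hasDerivAt_id z.1).prodMk (hasDerivAt_const z.1 z.2))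
    exact this.deriv
  have h2 : inner ℝ (u z) (spaceGrad φ z) = fderiv ℝ φ z (0, u z) := by
    have h3 : HasFDerivAt (fun x : Space d => (z.1, x))
        (ContinuousLinearMap.inr ℝ ℝ (Space d)) z.2 := hasFDerivAt_prodMk_right z.1 z.2
    have h4 : HasFDerivAt (fun x : Space d => φ (z.1, x))
        ((fderiv ℝ φ z).comp (ContinuousLinearMap.inr ℝ ℝ (Space d))) z.2 :=
      HasFDerivAt.comp z.2 (g := φ) (g' := fderiv ℝ φ z) hφ.hasFDerivAt h3
    rw [spaceGrad, gradient, real_inner_comm, InnerProductSpace.toDual_symm_apply, h4.fderiv]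
    simp
  rw [transport, h1, h2, ← map_add, ← smul_eq_mul, ← map_smul]
  simp [current]

theorem HasC1Bound.wellDefined {φ : SpaceTime d → ℝ} {C : ℝ} (hφ : HasC1Bound φ C)
    (h : IsAdmissible p u t) : WellDefined p u t φ where
  contDiff := hφ.contDiff
  integrable_transport := by
    simp only [mul_transport_eq (hφ.contDiff.differentiable one_ne_zero _)]
    exact hφ.integrableOn_fderiv h
  integrable_final := hφ.integrable_smul h.final
  integrable_initial := hφ.integrable_smul h.initial

theorem HasC1Bound.weakEquation_iff {φ : SpaceTime d → ℝ} {C : ℝ} (hφ : HasC1Bound φ C)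
    (h : IsAdmissible p u t) (ht : 0 ≤ t) : WeakEquation p u t φ ↔ defect p u t φ = 0 := by
  have key : ∫ s in (0 : ℝ)..t, ∫ x : Space d, p (s, x) * transport u φ (s, x) =
      ∫ z in slab d t, fderiv ℝ φ z (current p u z) := by
    simp only [mul_transport_eq (hφ.contDiff.differentiable one_ne_zero _)]
    rw [intervalIntegral.integral_of_le ht, ← integral_Icc_eq_integral_Ioc]
    have := hφ.integrableOn_fderiv h
    rw [slab, Measure.volume_eq_prod] at this ⊢
    rw [setIntegral_prod _ this]
    simp
  rw [WeakEquation, key, defect, sub_eq_zero]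
  rfl

theorem isAdmissible {T : ℝ} (hA3 : FlowAssumption T p) (hu : IsVelocity T p u)
    (ht : t ∈ Icc 0 T) : IsAdmissible p u t := by
  have hmeas := hA3.bounded.1
  have hvol : volume.restrict (slab d T) =
      (volume.restrict (Icc 0 T)).prod (volume : Measure (Space d)) := by
    rw [slab, Measure.volume_eq_prod, ← Measure.prod_restrict, Measure.restrict_univ]
  -- Nonnegativity is given on each time slice; `ae_prod_iff_ae_ae` asks for a measurable set, so a
  -- measurable representative of `p` is used.
  have hnn : ∀ᵐ z ∂volume.restrict (slab d T), 0 ≤ p z := by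
    obtain ⟨p', hp', h2⟩ := hmeas
    have h1 : ∀ᵐ z ∂volume.restrict (slab d T), 0 ≤ p' z := by
      rw [hvol] at h2 ⊢
      refine (Measure.ae_prod_iff_ae_ae (measurableSet_le measurable_const hp'.measurable)).2 ?_
      filter_upwards [Measure.ae_ae_of_ae_prod h2, ae_restrict_mem measurableSet_Icc] with s hs hsT
      filter_upwards [hs, hA3.nonneg s hsT] with x hx hx'
      rwa [← hx]
    filter_upwards [h1, h2] with z hz hz'
    rwa [hz']
  have hp : IntegrableOn p (slab d T) := by
    rw [IntegrableOn, hvol]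
    rw [hvol] at hmeas
    refine (integrable_prod_iff hmeas).2 ⟨?_, ?_⟩
    · filter_upwards [ae_restrict_mem measurableSet_Icc] with s hs using hA3.integrable s hs
    · refine (integrable_const (1 : ℝ)).congr ?_
      filter_upwards [ae_restrict_mem measurableSet_Icc] with s hs
      rw [← hA3.integral_eq_one s hs]
      refine integral_congr_ae ?_
      filter_upwards [hA3.nonneg s hs] with x hx
      rw [Real.norm_of_nonneg hx]
  have hpu : IntegrableOn (fun z => p z • u z) (slab d T) := by
    have := (integrable_withDensity_iff_integrable_smul₀' hmeas.aemeasurable.ennreal_ofReal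
      (Eventually.of_forall fun _ => ENNReal.ofReal_lt_top)).1 hu.integrable
    refine this.congr ?_
    filter_upwards [hnn] with z hz
    rw [ENNReal.toReal_ofReal hz]
  exact ⟨IntegrableOn.mono_set (Integrable.prodMk hp hpu)
      (prod_mono (Icc_subset_Icc_right ht.2) subset_rfl),
    hA3.integrable t ht, hA3.integrable 0 ⟨le_rfl, ht.1.trans ht.2⟩⟩

end

/-! ### Plane waves and their superpositions -/

/-- The Euclidean pairing of `ℝ × ℝ^d` with itself. It is spelled out because the product carries
the sup norm and no inner product. -/
def pairing (z : SpaceTime d) : SpaceTime d →L[ℝ] ℝ :=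
  z.1 • ContinuousLinearMap.fst ℝ ℝ (Space d) +
    (innerSL ℝ z.2).comp (ContinuousLinearMap.snd ℝ ℝ (Space d))

theorem pairing_apply (z ξ : SpaceTime d) : pairing z ξ = z.1 * ξ.1 + inner ℝ z.2 ξ.2 := by
  simp [pairing]

theorem pairing_comm (z ξ : SpaceTime d) : pairing z ξ = pairing ξ z := by
  rw [pairing_apply, pairing_apply, mul_comm, real_inner_comm]

theorem abs_pairing_le (z ξ : SpaceTime d) : |pairing z ξ| ≤ 2 * ‖z‖ * ‖ξ‖ := by
  have h1 : |z.1 * ξ.1| ≤ ‖z‖ * ‖ξ‖ := by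
    rw [abs_mul]
    gcongr
    exacts [norm_fst_le z, norm_fst_le ξ]
  have h2 : |inner ℝ z.2 ξ.2| ≤ ‖z‖ * ‖ξ‖ := by
    refine (abs_real_inner_le_norm _ _).trans ?_
    gcongr
    exacts [norm_snd_le z, norm_snd_le ξ]
  rw [pairing_apply]
  linarith [abs_add_le (z.1 * ξ.1) (inner ℝ z.2 ξ.2)]

theorem continuous_pairing : Continuous fun q : SpaceTime d × SpaceTime d => pairing q.1 q.2 := by
  simp only [pairing_apply]
  fun_prop

/-- The plane wave `ξ ↦ exp(i z ⬝ ξ)` of frequency `z`. -/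
def wave (z ξ : SpaceTime d) : ℂ := Complex.exp (Complex.I * (pairing z ξ : ℂ))

theorem continuous_wave : Continuous fun q : SpaceTime d × SpaceTime d => wave q.1 q.2 := by
  have := continuous_pairing (d := d)
  unfold wave
  fun_prop

theorem continuous_wave_left (ξ : SpaceTime d) : Continuous fun z => wave z ξ :=
  continuous_wave.comp (by fun_prop : Continuous fun z : SpaceTime d => (z, ξ))

theorem continuous_wave_right (z : SpaceTime d) : Continuous (wave z) :=
  continuous_wave.comp (by fun_prop : Continuous fun ξ : SpaceTime d => (z, ξ))

@[simp]
theorem norm_wave (z ξ : SpaceTime d) : ‖wave z ξ‖ = 1 := by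
  rw [wave, mul_comm, Complex.norm_exp_ofReal_mul_I]

theorem wave_sub (z ξ η : SpaceTime d) : wave z (ξ - η) = wave z (-η) * wave z ξ := by
  rw [wave, wave, wave, ← Complex.exp_add, map_sub, map_neg]
  push_cast
  ring_nf

@[simp]
theorem wave_zero_right (z : SpaceTime d) : wave z 0 = 1 := by simp [wave]

theorem hasFDerivAt_wave (z ξ : SpaceTime d) :
    HasFDerivAt (wave z) ((Complex.I * wave z ξ) • Complex.ofRealCLM.comp (pairing z)) ξ := by
  have h : HasFDerivAt (fun ξ => Complex.I * (pairing z ξ : ℂ))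
      (Complex.I • Complex.ofRealCLM.comp (pairing z)) ξ :=
    ((Complex.ofRealCLM.comp (pairing z)).hasFDerivAt).const_mul Complex.I
  convert! h.cexp using 1
  rw [smul_smul, mul_comm]
  rfl

theorem fderiv_wave_apply (z ξ v : SpaceTime d) :
    fderiv ℝ (wave z) ξ v = Complex.I * wave z ξ * pairing z v := by
  rw [(hasFDerivAt_wave z ξ).fderiv]
  simp

theorem contDiff_wave (z : SpaceTime d) {n : WithTop ℕ∞} : ContDiff ℝ n (wave z) := by
  unfold wave
  exact (contDiff_const.mul (Complex.ofRealCLM.contDiff.comp (pairing z).contDiff)).cexp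

theorem norm_smul_pairing_le (a : ℂ) (z : SpaceTime d) :
    ‖a • Complex.ofRealCLM.comp (pairing z)‖ ≤ 2 * (‖z‖ * ‖a‖) := by
  refine ContinuousLinearMap.opNorm_le_bound _ (by positivity) fun v => ?_
  have := abs_pairing_le z v
  have h : ‖(a • Complex.ofRealCLM.comp (pairing z)) v‖ = ‖a‖ * |pairing z v| := by simp
  rw [h]
  calc ‖a‖ * |pairing z v| ≤ ‖a‖ * (2 * ‖z‖ * ‖v‖) := by gcongr
    _ = _ := by ring

theorem norm_smul_wave_smul_pairing_le (a : ℂ) (z ξ : SpaceTime d) :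
    ‖a • (Complex.I * wave z ξ) • Complex.ofRealCLM.comp (pairing z)‖ ≤ 2 * (‖z‖ * ‖a‖) := by
  rw [smul_smul]
  refine (norm_smul_pairing_le _ _).trans ?_
  simp

theorem hasC1Bound_wave (z : SpaceTime d) : HasC1Bound (wave z) (1 + 2 * ‖z‖) where
  contDiff := contDiff_wave z
  norm_le ξ := by rw [norm_wave]; linarith [norm_nonneg z]
  norm_fderiv_le ξ := by
    rw [(hasFDerivAt_wave z ξ).fderiv]
    refine (norm_smul_pairing_le _ _).trans ?_
    simp

/-- `φ` is the superposition `∫ A(z) exp(i z ⬝ ξ) dz` of plane waves, with an amplitude `A` whose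
first moment is finite. -/
structure IsSuperposition (A : SpaceTime d → ℂ) (φ : SpaceTime d → ℂ) : Prop where
  integrable : Integrable A
  integrable_norm_mul : Integrable fun z => ‖z‖ * ‖A z‖
  eq_integral : ∀ ξ, φ ξ = ∫ z, A z * wave z ξ

namespace IsSuperposition

variable {A B : SpaceTime d → ℂ} {φ ψ : SpaceTime d → ℂ}

theorem integrable_mul_wave (h : IsSuperposition A φ) (ξ : SpaceTime d) :
    Integrable fun z => A z * wave z ξ := by
  refine h.integrable.norm.mono'
    (h.integrable.1.mul (continuous_wave_left ξ).aestronglyMeasurable) ?_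
  exact Eventually.of_forall fun z => by simp

theorem add (h : IsSuperposition A φ) (h' : IsSuperposition B ψ) :
    IsSuperposition (A + B) (φ + ψ) where
  integrable := h.integrable.add h'.integrable
  integrable_norm_mul := by
    refine (h.integrable_norm_mul.add h'.integrable_norm_mul).mono'
      (continuous_norm.aestronglyMeasurable.mul (h.integrable.1.add h'.integrable.1).norm) ?_
    refine Eventually.of_forall fun z => ?_
    have : ‖A z + B z‖ ≤ ‖A z‖ + ‖B z‖ := norm_add_le _ _
    simp only [Pi.add_apply, norm_mul, norm_norm]
    nlinarith [norm_nonneg z]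
  eq_integral ξ := by
    simp only [Pi.add_apply, add_mul]
    rw [integral_add (h.integrable_mul_wave ξ) (h'.integrable_mul_wave ξ), h.eq_integral,
      h'.eq_integral]

theorem congr_right (h : IsSuperposition A φ) (hψ : ∀ ξ, ψ ξ = φ ξ) : IsSuperposition A ψ :=
  ⟨h.integrable, h.integrable_norm_mul, fun ξ => (hψ ξ).trans (h.eq_integral ξ)⟩

theorem const_mul (h : IsSuperposition A φ) (c : ℂ) :
    IsSuperposition (fun z => c * A z) (fun ξ => c * φ ξ) where
  integrable := h.integrable.const_mul c
  integrable_norm_mul := by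
    refine (h.integrable_norm_mul.const_mul ‖c‖).congr (Eventually.of_forall fun z => ?_)
    simp only [norm_mul]
    ring
  eq_integral ξ := by
    simp only [mul_assoc]
    rw [integral_const_mul, ← h.eq_integral]

/-- Translation multiplies the amplitude by a phase. -/
theorem translate (h : IsSuperposition A φ) (η : SpaceTime d) :
    IsSuperposition (fun z => A z * wave z (-η)) (fun ξ => φ (ξ - η)) where
  integrable := h.integrable_mul_wave _
  integrable_norm_mul := by simpa using h.integrable_norm_mul
  eq_integral ξ := by simp only [h.eq_integral, wave_sub, mul_assoc]

theorem aestronglyMeasurable_fderiv (h : IsSuperposition A φ) (ξ : SpaceTime d) :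
    AEStronglyMeasurable
      (fun z => A z • (Complex.I * wave z ξ) • Complex.ofRealCLM.comp (pairing z)) := by
  refine h.integrable.1.smul (Continuous.aestronglyMeasurable ?_)
  refine Continuous.smul (continuous_const.mul (continuous_wave_left ξ)) ?_
  refine continuous_const.clm_comp ?_
  unfold pairing
  fun_prop

theorem hasFDerivAt (h : IsSuperposition A φ) (ξ : SpaceTime d) :
    HasFDerivAt φ (∫ z, A z • (Complex.I * wave z ξ) • Complex.ofRealCLM.comp (pairing z)) ξ := by
  rw [show φ = fun ξ => ∫ z, A z * wave z ξ from funext h.eq_integral]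
  refine hasFDerivAt_integral_of_dominated_of_fderiv_le
    (F' := fun ξ z => A z • (Complex.I * wave z ξ) • Complex.ofRealCLM.comp (pairing z))
    (bound := fun z => 2 * (‖z‖ * ‖A z‖))
    univ_mem (Eventually.of_forall fun ξ => (h.integrable_mul_wave ξ).1) (h.integrable_mul_wave ξ)
    (h.aestronglyMeasurable_fderiv ξ) (Eventually.of_forall fun z ξ _ => ?_)
    (h.integrable_norm_mul.const_mul 2)
    (Eventually.of_forall fun z ξ _ => (hasFDerivAt_wave z ξ).const_mul (A z))
  exact norm_smul_wave_smul_pairing_le _ _ _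

theorem integrable_fderiv (h : IsSuperposition A φ) (ξ : SpaceTime d) : Integrable
    (fun z => A z • (Complex.I * wave z ξ) • Complex.ofRealCLM.comp (pairing z)) := by
  refine (h.integrable_norm_mul.const_mul 2).mono' (h.aestronglyMeasurable_fderiv ξ)
    (Eventually.of_forall fun z => ?_)
  exact norm_smul_wave_smul_pairing_le _ _ _

theorem exists_hasC1Bound (h : IsSuperposition A φ) : ∃ C, HasC1Bound φ C := by
  refine ⟨max (∫ z, ‖A z‖) (∫ z, 2 * (‖z‖ * ‖A z‖)), ?_, fun ξ => ?_, fun ξ => ?_⟩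
  · refine contDiff_one_iff_hasFDerivAt.2 ⟨_, ?_, h.hasFDerivAt⟩
    refine continuous_of_dominated (bound := fun z => 2 * (‖z‖ * ‖A z‖))
      h.aestronglyMeasurable_fderiv (fun ξ => Eventually.of_forall fun z => ?_)
      (h.integrable_norm_mul.const_mul 2) (Eventually.of_forall fun z => ?_)
    · rw [smul_smul]
      refine (norm_smul_pairing_le _ _).trans ?_
      simp
    · have := continuous_wave_right z
      fun_prop
  · refine le_max_of_le_left ?_
    rw [h.eq_integral]
    refine (norm_integral_le_integral_norm _).trans_eq ?_
    simp
  · refine le_max_of_le_right ?_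
    rw [(h.hasFDerivAt ξ).fderiv]
    refine norm_integral_le_of_norm_le (h.integrable_norm_mul.const_mul 2)
      (Eventually.of_forall fun z => ?_)
    exact norm_smul_wave_smul_pairing_le _ _ _

theorem fderiv_apply (h : IsSuperposition A φ) (ξ v : SpaceTime d) :
    fderiv ℝ φ ξ v = ∫ z, A z * fderiv ℝ (wave z) ξ v := by
  rw [(h.hasFDerivAt ξ).fderiv, ContinuousLinearMap.integral_apply (h.integrable_fderiv ξ)]
  refine integral_congr_ae (Eventually.of_forall fun z => ?_)
  simp [fderiv_wave_apply]

/-- The integrand of a marginal term is integrable over position and frequency jointly, as Fubini's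
theorem requires. -/
theorem integrable_prod_smul_wave {ρ : Space d → ℝ} (h : IsSuperposition A φ) (hρ : Integrable ρ)
    (s : ℝ) : Integrable (Function.uncurry fun (x : Space d) z => ρ x • (A z * wave z (s, x)))
      (volume.prod volume) := by
  have hc : Continuous fun q : Space d × SpaceTime d => wave q.2 (s, q.1) :=
    continuous_wave.comp (by fun_prop : Continuous fun q : Space d × SpaceTime d => (q.2, (s, q.1)))
  refine (hρ.norm.mul_prod h.integrable.norm).mono' ?_ (Eventually.of_forall fun q => ?_)
  · exact hρ.1.comp_fst.smul (h.integrable.1.comp_snd.mul hc.aestronglyMeasurable)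
  · simp [Function.uncurry]

theorem integral_smul_eq {ρ : Space d → ℝ} (h : IsSuperposition A φ) (hρ : Integrable ρ)
    (s : ℝ) : ∫ x, ρ x • φ (s, x) = ∫ z, A z * ∫ x, ρ x • wave z (s, x) := by
  simp only [h.eq_integral, ← integral_smul]
  rw [integral_integral_swap (h.integrable_prod_smul_wave hρ s)]
  simp only [← mul_smul_comm, integral_const_mul]

theorem integrable_mul_integral {ρ : Space d → ℝ} (h : IsSuperposition A φ) (hρ : Integrable ρ)
    (s : ℝ) : Integrable fun z => A z * ∫ x, ρ x • wave z (s, x) := by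
  have := (h.integrable_prod_smul_wave hρ s).integral_prod_right
  simpa only [Function.uncurry, ← mul_smul_comm, integral_const_mul] using this

variable {p : SpaceTime d → ℝ} {u : SpaceTime d → Space d} {t : ℝ}

/-- The integrand of the transport term is integrable over position and frequency jointly; here the
first moment of the amplitude pays for the derivative of the wave. -/
theorem integrable_prod_fderiv (h : IsSuperposition A φ) (hp : IsAdmissible p u t) :
    Integrable (Function.uncurry fun ξ z => A z * fderiv ℝ (wave z) ξ (current p u ξ))
      ((volume.restrict (slab d t)).prod volume) := by
  refine ((hp.current.norm.const_mul 2).mul_prod h.integrable_norm_mul).mono' ?_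
    (Eventually.of_forall fun q => ?_)
  · simp only [Function.uncurry_def, fderiv_wave_apply]
    have hc : Continuous fun q : SpaceTime d × SpaceTime d => Complex.I * wave q.2 q.1 :=
      continuous_const.mul (continuous_wave.comp continuous_swap)
    have hJ : AEStronglyMeasurable (fun q : SpaceTime d × SpaceTime d => current p u q.1)
        ((volume.restrict (slab d t)).prod volume) :=
      AEStronglyMeasurable.comp_fst hp.current.aestronglyMeasurable
    have hm : AEStronglyMeasurable
        (fun q : SpaceTime d × SpaceTime d => (pairing q.2 (current p u q.1) : ℂ))
        ((volume.restrict (slab d t)).prod volume) :=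
      Continuous.comp_aestronglyMeasurable
        (g := fun q : SpaceTime d × SpaceTime d => (pairing q.1 q.2 : ℂ))
        (f := fun q : SpaceTime d × SpaceTime d => (q.2, current p u q.1))
        (Complex.continuous_ofReal.comp continuous_pairing)
        (continuous_snd.aestronglyMeasurable.prodMk hJ)
    have hA : AEStronglyMeasurable (fun q : SpaceTime d × SpaceTime d => A q.2)
        ((volume.restrict (slab d t)).prod volume) := h.integrable.1.comp_snd
    exact hA.mul (hc.aestronglyMeasurable.mul hm)
  · simp only [Function.uncurry_def, fderiv_wave_apply, norm_mul, Complex.norm_I, norm_wave,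
      Complex.norm_real, one_mul]
    have := abs_pairing_le q.2 (current p u q.1)
    calc ‖A q.2‖ * ‖pairing q.2 (current p u q.1)‖
        ≤ ‖A q.2‖ * (2 * ‖q.2‖ * ‖current p u q.1‖) := by gcongr; exact this
      _ = _ := by ring

theorem integrable_mul_defect (h : IsSuperposition A φ) (hp : IsAdmissible p u t) :
    Integrable fun z => A z * defect p u t (wave z) := by
  have h1 := (h.integrable_prod_fderiv hp).integral_prod_right
  simp only [Function.uncurry, integral_const_mul] at h1
  simp only [defect, mul_sub]
  exact h1.sub ((h.integrable_mul_integral hp.final t).sub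
    (h.integrable_mul_integral hp.initial 0))

/-- The defect of a superposition is the superposition of the defects of the plane waves. -/
theorem defect_eq (h : IsSuperposition A φ) (hp : IsAdmissible p u t) :
    defect p u t φ = ∫ z, A z * defect p u t (wave z) := by
  have h1 := (h.integrable_prod_fderiv hp).integral_prod_right
  simp only [Function.uncurry, integral_const_mul] at h1
  have h2 := h.integrable_mul_integral hp.final t
  have h3 := h.integrable_mul_integral hp.initial 0
  simp only [defect, mul_sub]
  have h23 := h2.sub h3
  simp only [Pi.sub_def] at h23
  rw [integral_sub h1 h23, integral_sub h2 h3, h.integral_smul_eq hp.final,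
    h.integral_smul_eq hp.initial]
  simp only [h.fderiv_apply]
  rw [integral_integral_swap (h.integrable_prod_fderiv hp)]
  simp only [integral_const_mul]

end IsSuperposition

/-! ### Fourier inversion on space-time -/

/-- The Fourier transform on space-time without a normalizing factor. -/
def waveTransform (f : SpaceTime d → ℂ) (z : SpaceTime d) : ℂ :=
  ∫ ξ, f ξ * wave z (-ξ)

/-- Space-time with its Euclidean norm, where Fourier inversion and Schwartz functions are
available. -/
abbrev HilbertSpaceTime (d : ℕ) : Type := WithLp 2 (ℝ × Space d)

theorem measurePreserving_ofLp :
    MeasurePreserving (WithLp.ofLp : HilbertSpaceTime d → SpaceTime d) :=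
  WithLp.volume_preserving_ofLp ℝ (Space d)

theorem measurableEmbedding_ofLp :
    MeasurableEmbedding (WithLp.ofLp : HilbertSpaceTime d → SpaceTime d) :=
  (MeasurableEquiv.toLp 2 (ℝ × Space d)).symm.measurableEmbedding

open scoped FourierTransform in
theorem fourier_ofLp (f : SpaceTime d → ℂ) (w : HilbertSpaceTime d) :
    𝓕 (fun v : HilbertSpaceTime d => f v.ofLp) w =
      waveTransform f ((2 * Real.pi) • w).ofLp := by
  rw [Real.fourier_eq', waveTransform,
    ← measurePreserving_ofLp.integral_comp measurableEmbedding_ofLp]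
  refine integral_congr_ae (Eventually.of_forall fun v => ?_)
  simp only [smul_eq_mul, wave, pairing_apply, WithLp.prod_inner_apply]
  rw [mul_comm]
  congr 2
  rw [mul_comm]
  congr 2
  simp [real_inner_smul_left, real_inner_comm]
  ring

theorem integrable_comp_ofLp_iff {F : Type*} [NormedAddCommGroup F] {f : SpaceTime d → F} :
    Integrable (fun w : HilbertSpaceTime d => f ((2 * Real.pi) • w).ofLp) ↔ Integrable f := by
  rw [integrable_comp_smul_iff volume (fun w : HilbertSpaceTime d => f w.ofLp)
    (by positivity : 2 * Real.pi ≠ 0)]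
  exact measurePreserving_ofLp.integrable_comp_emb measurableEmbedding_ofLp (g := f)

open scoped FourierTransform in
/-- Fourier inversion. Only the nonvanishing of the constant, which is `(2π)^{-(d+1)}`, matters. -/
theorem exists_inversion_const (d : ℕ) : ∃ c : ℂ, c ≠ 0 ∧ ∀ f : SpaceTime d → ℂ, Continuous f →
    Integrable f → Integrable (waveTransform f) →
    ∀ ξ, f ξ = ∫ z, c * waveTransform f z * wave z ξ := by
  refine ⟨((|((2 * Real.pi) ^ Module.finrank ℝ (HilbertSpaceTime d))⁻¹| : ℝ) : ℂ), ?_,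
    fun f hf hfi hF ξ => ?_⟩
  · have : 2 * Real.pi ≠ 0 := by positivity
    exact_mod_cast abs_ne_zero.2 (inv_ne_zero (pow_ne_zero _ this))
  have hg : Continuous fun v : HilbertSpaceTime d => f v.ofLp :=
    hf.comp (WithLp.prod_continuous_ofLp 2 ℝ (Space d))
  have hgi : Integrable fun v : HilbertSpaceTime d => f v.ofLp :=
    (measurePreserving_ofLp.integrable_comp_emb measurableEmbedding_ofLp (g := f)).2 hfi
  have hG : Integrable (𝓕 fun v : HilbertSpaceTime d => f v.ofLp) := by
    rw [funext (fourier_ofLp f)]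
    exact integrable_comp_ofLp_iff.2 hF
  have := congrFun (hg.fourierInv_fourier_eq hgi hG) (WithLp.toLp 2 ξ)
  rw [Real.fourierInv_eq'] at this
  refine this.symm.trans ?_
  simp only [fourier_ofLp]
  have h1 : ∀ w : HilbertSpaceTime d,
      Complex.exp (↑(2 * Real.pi * inner ℝ w (WithLp.toLp 2 ξ)) * Complex.I) •
        waveTransform f ((2 * Real.pi) • w).ofLp =
      (fun w : HilbertSpaceTime d => waveTransform f w.ofLp * wave w.ofLp ξ)
        ((2 * Real.pi) • w) := by
    intro w
    simp only [smul_eq_mul, wave, pairing_apply, WithLp.prod_inner_apply]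
    rw [mul_comm]
    congr 2
    rw [mul_comm]
    congr 2
    simp [real_inner_smul_left]
    ring
  rw [integral_congr_ae (Eventually.of_forall h1)]
  rw [Measure.integral_comp_smul volume
    (fun w : HilbertSpaceTime d => waveTransform f w.ofLp * wave w.ofLp ξ),
    measurePreserving_ofLp.integral_comp measurableEmbedding_ofLp
    (fun z => waveTransform f z * wave z ξ)]
  simp only [mul_assoc]
  rw [integral_const_mul, Complex.real_smul]

theorem continuous_waveTransform {f : SpaceTime d → ℂ} (hf : Integrable f) :
    Continuous (waveTransform f) := by
  refine continuous_of_dominated (bound := fun ξ => ‖f ξ‖) (fun z => ?_)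
    (fun z => Eventually.of_forall fun ξ => by simp) hf.norm (Eventually.of_forall fun ξ => ?_)
  · exact hf.1.mul ((continuous_wave_right z).comp continuous_neg).aestronglyMeasurable
  · exact continuous_const.mul (continuous_wave_left (-ξ))

theorem eq_zero_of_waveTransform_eq_zero {f : SpaceTime d → ℂ} (hf : Continuous f)
    (hfi : Integrable f) (h : ∀ z, waveTransform f z = 0) : f = 0 := by
  obtain ⟨c, -, hc⟩ := exists_inversion_const d
  have h0 : waveTransform f = 0 := funext h
  have := hc f hf hfi (by rw [h0]; exact integrable_zero _ _ _)
  ext ξ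
  simp [this ξ, h0]

open scoped FourierTransform in
/-- A test function is a Schwartz function, so its Fourier transform has all moments. -/
theorem IsTest.exists_isSuperposition {φ : SpaceTime d → ℝ} (h : IsTest φ) :
    ∃ A, IsSuperposition A fun ξ => (φ ξ : ℂ) := by
  obtain ⟨c, -, hc⟩ := exists_inversion_const d
  set f : SpaceTime d → ℂ := fun ξ => (φ ξ : ℂ) with hf
  have hfs : ContDiff ℝ ∞ f := Complex.ofRealCLM.contDiff.comp h.smooth
  have hfc : HasCompactSupport f := h.compactSupport.comp_left (g := fun x : ℝ => (x : ℂ)) (by simp)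
  let e := WithLp.prodContinuousLinearEquiv 2 ℝ ℝ (Space d)
  have hg : HasCompactSupport fun v : HilbertSpaceTime d => f v.ofLp :=
    hfc.comp_homeomorph e.toHomeomorph
  let S := hg.toSchwartzMap (hfs.comp e.contDiff)
  have hS : ∀ w, (𝓕 S) w = waveTransform f ((2 * Real.pi) • w).ofLp := fun w => by
    rw [SchwartzMap.fourier_coe]
    exact fourier_ofLp f w
  have h0 : Integrable (waveTransform f) := by
    refine integrable_comp_ofLp_iff.1 (((𝓕 S).integrable (μ := volume)).congr ?_)
    exact Eventually.of_forall hS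
  have h1 : Integrable fun z => ‖z‖ * ‖waveTransform f z‖ := by
    refine integrable_comp_ofLp_iff.1 ?_
    have hi := ((𝓕 S).integrable_pow_mul volume 1).const_mul (2 * Real.pi)
    refine hi.mono' ?_ (Eventually.of_forall fun w => ?_)
    · refine AEStronglyMeasurable.mul (Continuous.aestronglyMeasurable ?_) ?_
      · exact (e.continuous.comp (continuous_const_smul (2 * Real.pi))).norm
      · simp only [← hS]
        exact (𝓕 S).continuous.norm.aestronglyMeasurable
    · rw [← hS, pow_one, norm_mul, norm_norm, norm_norm, ← mul_assoc]
      gcongr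
      have : ‖((2 * Real.pi) • w).ofLp‖ ≤ ‖(2 * Real.pi) • w‖ := by
        have := (WithLp.prod_lipschitzWith_ofLp 2 ℝ (Space d)).norm_sub_le
          ((2 * Real.pi) • w) 0
        simpa using this
      rwa [norm_smul, Real.norm_of_nonneg (by positivity)] at this
  exact ⟨fun z => c * waveTransform f z, h0.const_mul c, by
    refine (h1.const_mul ‖c‖).congr (Eventually.of_forall fun z => ?_)
    simp only [norm_mul]
    ring, hc f hfs.continuous (hfs.continuous.integrable_of_hasCompactSupport hfc) h0⟩

/-! ### The reproducing kernel Hilbert space -/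

variable {K : SpaceTime d → ℝ}

theorem exists_fourierTransform_eq (K : SpaceTime d → ℝ) : ∃ κ : ℂ, κ ≠ 0 ∧
    ∀ z, fourierTransform K z = κ * waveTransform (fun ξ => (K ξ : ℂ)) z := by
  refine ⟨(((2 * Real.pi) ^ (-((d : ℝ) + 1) / 2) : ℝ) : ℂ), ?_, fun z => ?_⟩
  · have : (0 : ℝ) < (2 * Real.pi) ^ (-((d : ℝ) + 1) / 2) := by positivity
    exact_mod_cast this.ne'
  · rw [fourierTransform, waveTransform]
    congr 1
    refine integral_congr_ae (Eventually.of_forall fun ξ => ?_)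
    simp only [wave, map_neg, pairing_apply]
    push_cast
    rw [mul_neg, mul_comm]

theorem sq_norm_le (z : SpaceTime d) : ‖z‖ ^ 2 ≤ z.1 ^ 2 + ‖z.2‖ ^ 2 := by
  rw [Prod.norm_def]
  rcases max_cases ‖z.1‖ ‖z.2‖ with ⟨h, -⟩ | ⟨h, -⟩ <;> rw [h]
  · rw [Real.norm_eq_abs, sq_abs]
    nlinarith [norm_nonneg z.2]
  · nlinarith [sq_nonneg z.1]

/-- By Fourier inversion the kernel is a superposition of plane waves, with a continuous amplitude
proportional to `K̂`; the full support of `K̂` makes the amplitude nonzero on a dense set. -/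
theorem exists_superposition_kernel (hA1 : KernelAssumption K) (hA2 : KernelMoment K) :
    ∃ A : SpaceTime d → ℂ, Continuous A ∧ Dense {z | A z ≠ 0} ∧
      IsSuperposition A (fun ξ => (K ξ : ℂ)) ∧ Integrable fun z => ‖z‖ ^ 2 * ‖A z‖ := by
  obtain ⟨κ, hκ, hF⟩ := exists_fourierTransform_eq K
  obtain ⟨c, hc, hinv⟩ := exists_inversion_const d
  set k : SpaceTime d → ℂ := fun ξ => (K ξ : ℂ) with hk
  have hkc : Continuous k := Complex.continuous_ofReal.comp hA1.continuous
  have hki : Integrable k := hA1.integrable.ofReal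
  have hW : Continuous (waveTransform k) := continuous_waveTransform hki
  -- The moment assumption bounds every moment of order at most two.
  have hdom : ∀ g : SpaceTime d → ℝ, Continuous g → (∀ z, |g z| ≤ 1 + ‖z‖ ^ 2) →
      Integrable fun z => g z * ‖waveTransform k z‖ := by
    intro g hg hgb
    refine (hA2.norm.const_mul ‖κ‖⁻¹).mono' (hg.mul hW.norm).aestronglyMeasurable
      (Eventually.of_forall fun z => ?_)
    have h0 : (0 : ℝ) ≤ 1 + (z.1 ^ 2 + ‖z.2‖ ^ 2) := by positivity
    have hκ' : ‖κ‖ ≠ 0 := norm_ne_zero_iff.2 hκ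
    rw [hF, norm_smul, norm_mul, Real.norm_of_nonneg h0, norm_mul, norm_norm, Real.norm_eq_abs]
    calc |g z| * ‖waveTransform k z‖ ≤ (1 + (z.1 ^ 2 + ‖z.2‖ ^ 2)) * ‖waveTransform k z‖ := by
          gcongr
          linarith [hgb z, sq_norm_le z]
      _ = _ := by field_simp
  have h0 : Integrable (waveTransform k) := by
    have := hdom 1 continuous_const (fun z => by simp)
    simp only [Pi.one_apply, one_mul] at this
    exact (integrable_norm_iff hW.aestronglyMeasurable).1 this
  have h1 := hdom (fun z => ‖z‖) continuous_norm (fun z => by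
    rw [abs_norm]; nlinarith [sq_nonneg (‖z‖ - 1)])
  have h2 := hdom (fun z => ‖z‖ ^ 2) (continuous_norm.pow 2) (fun z => by
    rw [abs_of_nonneg (by positivity)]; linarith)
  refine ⟨fun z => c * waveTransform k z, continuous_const.mul hW, ?_,
    ⟨h0.const_mul c, ?_, hinv k hkc hki h0⟩, ?_⟩
  · rw [dense_iff_closure_eq, ← hA1.fullSupport, tsupport]
    congr 1
    ext z
    simp [hF, hκ, hc]
  · refine (h1.const_mul ‖c‖).congr (Eventually.of_forall fun z => ?_)
    simp only [norm_mul]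
    ring
  · refine (h2.const_mul ‖c‖).congr (Eventually.of_forall fun z => ?_)
    simp only [norm_mul]
    ring

theorem norm_two_sub_wave_le (z v : SpaceTime d) :
    ‖2 - wave z v - wave z (-v)‖ ≤ 4 * ‖v‖ ^ 2 * ‖z‖ ^ 2 := by
  have h1 : 2 - wave z v - wave z (-v) = ((2 * (1 - Real.cos (pairing z v)) : ℝ) : ℂ) := by
    have := Complex.two_cos (pairing z v : ℂ)
    push_cast
    rw [mul_sub, this, wave, wave, map_neg]
    push_cast
    ring_nf
  have h2 := Real.one_sub_sq_div_two_le_cos (x := pairing z v)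
  have h3 : pairing z v ^ 2 ≤ (2 * ‖z‖ * ‖v‖) ^ 2 := sq_le_sq' (by
    linarith [neg_abs_le (pairing z v), abs_pairing_le z v])
    ((le_abs_self _).trans (abs_pairing_le z v))
  rw [h1, Complex.norm_real, Real.norm_of_nonneg (by linarith [Real.cos_le_one (pairing z v)])]
  nlinarith

/-- The left side is the squared distance of two kernel functions in the Hilbert space, so the bound
says that `x ↦ K(· - x)` is Lipschitz. Evenness of `K` removes the first-order term, and the second
moment of `K̂` bounds the rest. -/
theorem exists_kernel_modulus (hA1 : KernelAssumption K) (hA2 : KernelMoment K) :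
    ∃ C : ℝ, 0 ≤ C ∧ ∀ v, 2 * K 0 - 2 * K v ≤ (C * ‖v‖) ^ 2 := by
  obtain ⟨A, -, -, hA, hA2⟩ := exists_superposition_kernel hA1 hA2
  have hM : 0 ≤ ∫ z, ‖z‖ ^ 2 * ‖A z‖ := integral_nonneg fun z => by positivity
  refine ⟨2 * √(∫ z, ‖z‖ ^ 2 * ‖A z‖), by positivity, fun v => ?_⟩
  have h1 : ((2 * K 0 - 2 * K v : ℝ) : ℂ) = ∫ z, A z * (2 - wave z v - wave z (-v)) := by
    have hv : (K v : ℂ) = K (-v) := by rw [hA1.posDef.symm]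
    have e : ∀ z, A z * (2 - wave z v - wave z (-v)) =
        2 * (A z * wave z 0) - A z * wave z v - A z * wave z (-v) := fun z => by
      rw [wave_zero_right]
      ring
    simp only [e]
    have i0 := (hA.integrable_mul_wave 0).const_mul 2
    have i1 := hA.integrable_mul_wave v
    have i2 := i0.sub i1
    simp only [Pi.sub_def] at i2
    rw [integral_sub i2 (hA.integrable_mul_wave _), integral_sub i0 i1, integral_const_mul,
      ← hA.eq_integral, ← hA.eq_integral, ← hA.eq_integral, ← hv]
    push_cast
    ring
  calc 2 * K 0 - 2 * K v ≤ ‖((2 * K 0 - 2 * K v : ℝ) : ℂ)‖ := by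
        rw [Complex.norm_real]
        exact le_abs_self _
    _ ≤ ∫ z, 4 * ‖v‖ ^ 2 * (‖z‖ ^ 2 * ‖A z‖) := by
        rw [h1]
        refine norm_integral_le_of_norm_le (hA2.const_mul _) (Eventually.of_forall fun z => ?_)
        rw [norm_mul]
        have := norm_two_sub_wave_le z v
        calc ‖A z‖ * ‖2 - wave z v - wave z (-v)‖ ≤ ‖A z‖ * (4 * ‖v‖ ^ 2 * ‖z‖ ^ 2) := by gcongr
          _ = _ := by ring
    _ = _ := by
        rw [integral_const_mul, mul_pow, mul_pow, Real.sq_sqrt hM]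
        ring

section RKHS

variable [Fact (kernelMatrix K).PosSemidef]

/-- The finite linear combinations of kernel functions, a dense subspace of the reproducing kernel
Hilbert space. -/
def kernelSpan (K : SpaceTime d → ℝ) [Fact (kernelMatrix K).PosSemidef] :
    Submodule ℝ (RKHS.OfKernel (kernelMatrix K)) :=
  Submodule.span ℝ {f | ∃ x v, RKHS.kerFun (RKHS.OfKernel (kernelMatrix K)) x v = f}

theorem kerFun_ofKernel_apply (x y : SpaceTime d) (v : ℝ) :
    RKHS.kerFun (RKHS.OfKernel (kernelMatrix K)) y v x = K (x - y) * v := by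
  rw [RKHS.kerFun_apply, RKHS.OfKernel.kernel_ofKernel]
  simp [kernelMatrix]

theorem inner_kerFun_ofKernel (x y : SpaceTime d) :
    inner ℝ (RKHS.kerFun (RKHS.OfKernel (kernelMatrix K)) x 1)
      (RKHS.kerFun (RKHS.OfKernel (kernelMatrix K)) y 1) = K (x - y) := by
  rw [RKHS.kerFun_inner, kerFun_ofKernel_apply]
  simp

/-- Elements of the Hilbert space are Lipschitz functions, with constant proportional to the norm:
this is the reproducing property and the Cauchy–Schwarz inequality. -/
theorem abs_sub_le_of_modulus (hsymm : ∀ ξ, K (-ξ) = K ξ) {C : ℝ} (hC0 : 0 ≤ C)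
    (hC : ∀ v, 2 * K 0 - 2 * K v ≤ (C * ‖v‖) ^ 2)
    (f : RKHS.OfKernel (kernelMatrix K)) (x y : SpaceTime d) :
    |f x - f y| ≤ C * ‖f‖ * ‖x - y‖ := by
  set k := fun x => RKHS.kerFun (RKHS.OfKernel (kernelMatrix K)) x 1 with hk
  have h1 : f x - f y = inner ℝ (k x - k y) f := by
    rw [inner_sub_left, hk]
    simp [RKHS.kerFun_inner]
  have h2 : ‖k x - k y‖ ^ 2 ≤ (C * ‖x - y‖) ^ 2 := by
    refine le_trans (le_of_eq ?_) (hC (x - y))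
    rw [← real_inner_self_eq_norm_sq, inner_sub_left, inner_sub_right, inner_sub_right, hk]
    simp only [inner_kerFun_ofKernel, sub_self]
    rw [← hsymm (y - x), neg_sub]
    ring
  have h3 : ‖k x - k y‖ ≤ C * ‖x - y‖ := le_of_sq_le_sq h2 (by positivity)
  rw [h1]
  calc |inner ℝ (k x - k y) f| ≤ ‖k x - k y‖ * ‖f‖ := abs_real_inner_le_norm _ _
    _ ≤ C * ‖x - y‖ * ‖f‖ := by gcongr
    _ = _ := by ring

theorem exists_isSuperposition_of_mem_kernelSpan {A : SpaceTime d → ℂ}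
    (hA : IsSuperposition A fun ξ => (K ξ : ℂ)) {f : RKHS.OfKernel (kernelMatrix K)}
    (hf : f ∈ kernelSpan K) : ∃ B, IsSuperposition B fun ξ => (f ξ : ℂ) := by
  induction hf using Submodule.span_induction with
  | mem f hf =>
    obtain ⟨y, v, rfl⟩ := hf
    refine ⟨_, ((hA.translate y).const_mul v).congr_right fun ξ => ?_⟩
    rw [kerFun_ofKernel_apply]
    push_cast
    ring
  | zero => exact ⟨0, integrable_zero _ _ _, by simp, by simp⟩
  | add f g _ _ hf hg =>
    obtain ⟨B, hB⟩ := hf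
    obtain ⟨B', hB'⟩ := hg
    exact ⟨_, (hB.add hB').congr_right fun ξ => by simp⟩
  | smul c f _ hf =>
    obtain ⟨B, hB⟩ := hf
    exact ⟨_, (hB.const_mul c).congr_right fun ξ => by simp⟩

theorem norm_fderiv_le_of_modulus (hsymm : ∀ ξ, K (-ξ) = K ξ) {C : ℝ} (hC0 : 0 ≤ C)
    (hC : ∀ v, 2 * K 0 - 2 * K v ≤ (C * ‖v‖) ^ 2)
    (f : RKHS.OfKernel (kernelMatrix K)) (x : SpaceTime d) :
    ‖fderiv ℝ f x‖ ≤ C * ‖f‖ := by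
  have := norm_fderiv_le_of_lipschitz ℝ (f := f) (x₀ := x) (C := ⟨C * ‖f‖, by positivity⟩)
    (LipschitzWith.of_dist_le_mul fun x y => by
      rw [Real.dist_eq, dist_eq_norm]
      exact abs_sub_le_of_modulus hsymm hC0 hC f x y)
  exact this

/-- Convergence in the Hilbert space is convergence in `C¹`. On the span the derivative is bounded
by the norm through the Lipschitz estimate, so along a sequence of the span that converges to `f`
the derivatives converge uniformly; in particular `f` is `C¹`. -/
theorem exists_seq_kernelSpan (hA1 : KernelAssumption K) (hA2 : KernelMoment K)
    (f : RKHS.OfKernel (kernelMatrix K)) :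
    ∃ (F : ℕ → RKHS.OfKernel (kernelMatrix K)) (M : ℝ), (∀ n, F n ∈ kernelSpan K) ∧
      (∀ n, HasC1Bound (F n) M) ∧ HasC1Bound f M ∧
      (∀ z, Tendsto (fun n => F n z) atTop (𝓝 (f z))) ∧
      ∀ z, Tendsto (fun n => fderiv ℝ (F n) z) atTop (𝓝 (fderiv ℝ f z)) := by
  obtain ⟨A, -, -, hA, -⟩ := exists_superposition_kernel hA1 hA2
  obtain ⟨C, hC0, hC⟩ := exists_kernel_modulus hA1 hA2
  have hdense : f ∈ closure (kernelSpan K : Set (RKHS.OfKernel (kernelMatrix K))) := by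
    have := RKHS.kerFun_dense (RKHS.OfKernel (kernelMatrix K))
    rw [← Submodule.topologicalClosure_coe]
    exact this.symm ▸ Submodule.mem_top
  obtain ⟨F, hF, hlim⟩ := mem_closure_iff_seq_limit.1 hdense
  have hcd : ∀ g ∈ kernelSpan K, ContDiff ℝ 1 g := by
    intro g hg
    obtain ⟨B, hB⟩ := exists_isSuperposition_of_mem_kernelSpan hA hg
    obtain ⟨M, hM⟩ := hB.exists_hasC1Bound
    simpa using (hM.clm_comp Complex.reCLM).contDiff
  have hder : ∀ n m z, ‖fderiv ℝ (F n) z - fderiv ℝ (F m) z‖ ≤ C * ‖F n - F m‖ := by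
    intro n m z
    have := norm_fderiv_le_of_modulus hA1.posDef.symm hC0 hC (F n - F m) z
    rwa [RKHS.coe_sub, fderiv_sub ((hcd _ (hF n)).differentiable one_ne_zero z)
      ((hcd _ (hF m)).differentiable one_ne_zero z)] at this
  have hcauchy : ∀ z, CauchySeq fun n => fderiv ℝ (F n) z := by
    intro z
    rw [Metric.cauchySeq_iff']
    intro ε hε
    obtain ⟨N, hN⟩ := Metric.cauchySeq_iff'.1 hlim.cauchySeq (ε / (C + 1)) (by positivity)
    refine ⟨N, fun n hn => ?_⟩
    have h1 := hN n hn
    rw [dist_eq_norm, lt_div_iff₀ (by positivity)] at h1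
    rw [dist_eq_norm]
    nlinarith [hder n N z, norm_nonneg (F n - F N)]
  choose g' hg' using fun z => cauchySeq_tendsto_of_complete (hcauchy z)
  have hunif : TendstoUniformly (fun n z => fderiv ℝ (F n) z) g' atTop := by
    have h0 : Tendsto (fun n => C * ‖F n - f‖) atTop (𝓝 0) := by
      simpa using (tendsto_iff_norm_sub_tendsto_zero.1 hlim).const_mul C
    rw [Metric.tendstoUniformly_iff]
    intro ε hε
    filter_upwards [h0.eventually (gt_mem_nhds hε)] with n hn z
    rw [dist_comm, dist_eq_norm]
    refine lt_of_le_of_lt (le_of_tendsto_of_tendsto ((tendsto_const_nhds.sub (hg' z)).norm)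
      ((tendsto_const_nhds.sub hlim).norm.const_mul C) (Eventually.of_forall fun m => ?_)) hn
    exact hder n m z
  have hpt : ∀ z, Tendsto (fun n => F n z) atTop (𝓝 (f z)) := fun z =>
    ((RKHS.continuous_eval z).tendsto f).comp hlim
  have hfd : ∀ z, HasFDerivAt f (g' z) z := hasFDerivAt_of_tendstoUniformly hunif
    (fun n z => ((hcd _ (hF n)).differentiable one_ne_zero z).hasFDerivAt) hpt
  have hg'c : Continuous g' := hunif.continuous
    (Eventually.of_forall fun n => (hcd _ (hF n)).continuous_fderiv one_ne_zero).frequently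
  obtain ⟨R, hR⟩ := (Metric.isBounded_range_of_tendsto F hlim).exists_norm_le
  have hR' : ∀ n, ‖F n‖ ≤ R := fun n => hR _ (mem_range_self n)
  have hfR : ‖f‖ ≤ R := le_of_tendsto hlim.norm (Eventually.of_forall hR')
  have hR0 : 0 ≤ R := (norm_nonneg _).trans hfR
  have hval : ∀ g : RKHS.OfKernel (kernelMatrix K), ∀ z, ‖g z‖ ≤ ‖g‖ * √|K 0| := by
    intro g z
    refine (RKHS.norm_apply_le g z).trans_eq ?_
    rw [RKHS.OfKernel.kernel_ofKernel]
    simp [kernelMatrix, norm_smul]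
  have hbd : ∀ g : RKHS.OfKernel (kernelMatrix K), ‖g‖ ≤ R → ContDiff ℝ 1 g →
      HasC1Bound g (max (R * √|K 0|) (C * R)) := fun g hg hgc =>
    ⟨hgc, fun z => le_max_of_le_left ((hval g z).trans (by gcongr)),
      fun z => le_max_of_le_right
        ((norm_fderiv_le_of_modulus hA1.posDef.symm hC0 hC g z).trans (by gcongr))⟩
  refine ⟨F, _, hF, fun n => hbd _ (hR' n) (hcd _ (hF n)),
    hbd f hfR (contDiff_one_iff_hasFDerivAt.2 ⟨g', hg'c, hfd⟩), hpt, fun z => ?_⟩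
  rw [(hfd z).fderiv]
  exact hg' z

end RKHS

/-! ### Plane waves decide the equation -/

variable {p : SpaceTime d → ℝ} {u : SpaceTime d → Space d} {t : ℝ}

theorem norm_fderiv_wave_le (z ξ : SpaceTime d) : ‖fderiv ℝ (wave z) ξ‖ ≤ 1 + 2 * ‖z‖ :=
  (hasC1Bound_wave z).norm_fderiv_le ξ

theorem continuous_defect_wave (h : IsAdmissible p u t) :
    Continuous fun z => defect p u t (wave z) := by
  refine continuous_iff_continuousAt.2 fun z₀ => ?_
  refine tendsto_defect (C := 1 + 2 * (‖z₀‖ + 1)) h ?_ (fun ξ => ?_) (fun ξ => ?_)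
  · have : ∀ᶠ z in 𝓝 z₀, ‖z‖ < ‖z₀‖ + 1 :=
      continuous_norm.continuousAt.eventually_lt continuousAt_const (lt_add_one _)
    filter_upwards [this] with z hz
    have hb := hasC1Bound_wave z
    exact ⟨hb.contDiff, fun ξ => (hb.norm_le ξ).trans (by linarith),
      fun ξ => (hb.norm_fderiv_le ξ).trans (by linarith)⟩
  · exact (continuous_wave_left ξ).tendsto z₀
  · have hc : Continuous fun z : SpaceTime d => fderiv ℝ (wave z) ξ := by
      simp only [(hasFDerivAt_wave _ ξ).fderiv]
      refine (continuous_const.mul (continuous_wave_left ξ)).smul (continuous_const.clm_comp ?_)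
      unfold pairing
      fun_prop
    exact hc.tendsto z₀

/-- A plane wave is the limit of its products with the dilated cutoffs `χ(r ·)` as `r → 0`, whose
real and imaginary parts are test functions. -/
theorem defect_wave_eq_zero_of_isTest (h : IsAdmissible p u t)
    (htest : ∀ φ : SpaceTime d → ℝ, IsTest φ → defect p u t φ = 0) (z : SpaceTime d) :
    defect p u t (wave z) = 0 := by
  let χ : ContDiffBump (0 : SpaceTime d) := ⟨1, 2, one_pos, one_lt_two⟩
  have hχ : ContDiff ℝ ∞ χ := χ.contDiff
  have hχd : Differentiable ℝ χ := hχ.differentiable (by simp)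
  obtain ⟨M, hM⟩ := (χ.hasCompactSupport.fderiv ℝ).exists_bound_of_continuous
    (hχ.continuous_fderiv (by simp))
  have hM0 : 0 ≤ M := (norm_nonneg _).trans (hM 0)
  let φ : ℝ → SpaceTime d → ℂ := fun r ξ => (χ (r • ξ)) • wave z ξ
  have hφs : ∀ r, ContDiff ℝ ∞ (φ r) := fun r =>
    (hχ.comp (contDiff_const_smul r)).smul (contDiff_wave z)
  have hφc : ∀ r, r ≠ 0 → HasCompactSupport (φ r) := fun r hr =>
    (χ.hasCompactSupport.comp_smul hr).smul_right
  have hd : ∀ r ξ, HasFDerivAt (φ r) (χ (r • ξ) • fderiv ℝ (wave z) ξ +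
      (r • fderiv ℝ χ (r • ξ)).smulRight (wave z ξ)) ξ := by
    intro r ξ
    have h1 : HasFDerivAt (fun ξ : SpaceTime d => χ (r • ξ)) (r • fderiv ℝ χ (r • ξ)) ξ := by
      have h2 : HasFDerivAt (fun ξ : SpaceTime d => r • ξ)
          (r • ContinuousLinearMap.id ℝ (SpaceTime d)) ξ := (hasFDerivAt_id ξ).const_smul r
      have := HasFDerivAt.comp ξ (g := χ) (g' := fderiv ℝ χ (r • ξ)) (hχd _).hasFDerivAt h2
      rwa [ContinuousLinearMap.comp_smul, ContinuousLinearMap.comp_id] at this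
    exact h1.smul (((contDiff_wave z (n := 1)).differentiable one_ne_zero) ξ).hasFDerivAt
  -- For `r < 1` the derivative of the cutoff is no larger than that of `χ`.
  have hbound : ∀ᶠ r in 𝓝[>] (0 : ℝ), HasC1Bound (φ r) (1 + 2 * ‖z‖ + M) := by
    filter_upwards [Ioo_mem_nhdsGT one_pos] with r hr
    have hχ1 : ∀ ξ, ‖χ ξ‖ ≤ 1 := fun ξ => by
      rw [Real.norm_of_nonneg χ.nonneg]
      exact χ.le_one
    refine ⟨(hφs r).of_le (by simp), fun ξ => ?_, fun ξ => ?_⟩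
    · rw [norm_smul, norm_wave, mul_one]
      linarith [hχ1 (r • ξ), norm_nonneg z]
    · rw [(hd r ξ).fderiv]
      refine (norm_add_le _ _).trans (add_le_add ?_ ?_)
      · rw [norm_smul]
        calc _ ≤ 1 * (1 + 2 * ‖z‖) := by
              gcongr
              exacts [hχ1 _, norm_fderiv_wave_le z ξ]
          _ = _ := one_mul _
      · rw [ContinuousLinearMap.norm_smulRight_apply, norm_wave, mul_one, norm_smul,
          Real.norm_of_nonneg hr.1.le]
        calc _ ≤ 1 * M := by
              gcongr
              exacts [hr.2.le, hM _]
          _ = M := one_mul _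
  have hr0 : Tendsto (fun r : ℝ => r) (𝓝[>] 0) (𝓝 0) := tendsto_id.mono_left nhdsWithin_le_nhds
  have hχlim : ∀ ξ : SpaceTime d, Tendsto (fun r : ℝ => χ (r • ξ)) (𝓝[>] 0) (𝓝 1) := by
    intro ξ
    have h1 : Tendsto (fun r : ℝ => r • ξ) (𝓝[>] 0) (𝓝 0) := by simpa using hr0.smul_const ξ
    have h2 : χ 0 = 1 := χ.one_of_mem_closedBall (by simp [χ])
    rw [← h2]
    exact (hχ.continuous.tendsto 0).comp h1
  have hlim := tendsto_defect (ψ := wave z) h hbound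
    (fun ξ => by simpa [φ] using (hχlim ξ).smul_const (wave z ξ)) (fun ξ => by
      simp only [fun r => (hd r ξ).fderiv]
      have h1 : Tendsto (fun r : ℝ => (r • fderiv ℝ χ (r • ξ)).smulRight (wave z ξ))
          (𝓝[>] 0) (𝓝 0) := by
        refine squeeze_zero_norm (a := fun r => |r| * M) (fun r => ?_) (by
          simpa using hr0.abs.mul_const M)
        rw [ContinuousLinearMap.norm_smulRight_apply, norm_wave, mul_one, norm_smul,
          Real.norm_eq_abs]
        gcongr
        exact hM _
      simpa using ((hχlim ξ).smul_const (fderiv ℝ (wave z) ξ)).add h1)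
  refine tendsto_nhds_unique hlim (tendsto_const_nhds.congr' ?_)
  filter_upwards [hbound, self_mem_nhdsWithin] with r hb hr
  have hr' : r ≠ 0 := ne_of_gt hr
  have hre := defect_clm_comp hb h Complex.reCLM
  have him := defect_clm_comp hb h Complex.imCLM
  rw [htest (fun ξ => Complex.reCLM (φ r ξ)) ⟨Complex.reCLM.contDiff.comp (hφs r),
    (hφc r hr').comp_left (map_zero Complex.reCLM)⟩] at hre
  rw [htest (fun ξ => Complex.imCLM (φ r ξ)) ⟨Complex.imCLM.contDiff.comp (hφs r),
    (hφc r hr').comp_left (map_zero Complex.imCLM)⟩] at him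
  exact Complex.ext hre him

theorem defect_eq_zero_of_isSuperposition (h : IsAdmissible p u t)
    (hw : ∀ z : SpaceTime d, defect p u t (wave z) = 0) {A : SpaceTime d → ℂ}
    {φ : SpaceTime d → ℝ} {C : ℝ} (hφ : HasC1Bound φ C)
    (hA : IsSuperposition A fun ξ => (φ ξ : ℂ)) : defect p u t φ = 0 := by
  have h1 := defect_clm_comp hφ h Complex.ofRealCLM
  have h2 := hA.defect_eq h
  simp only [hw, mul_zero, integral_zero] at h2
  simp only [Complex.ofRealCLM_apply] at h1
  exact_mod_cast h1.symm.trans h2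

/-- Write `A` for the amplitude of the kernel and `ℓ` for the defect of the plane waves. The defect
of `K(· - η)` is the Fourier transform of `A ℓ` at `η`, so `A ℓ` vanishes; `ℓ` is continuous and
`A` is nonzero on a dense set, so `ℓ` vanishes. -/
theorem defect_wave_eq_zero_of_translates (h : IsAdmissible p u t) (hA1 : KernelAssumption K)
    (hA2 : KernelMoment K) (hK : ∀ η, defect p u t (fun ξ => K (ξ - η)) = 0) (z : SpaceTime d) :
    defect p u t (wave z) = 0 := by
  obtain ⟨A, hAc, hAd, hA, -⟩ := exists_superposition_kernel hA1 hA2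
  have hℓ := continuous_defect_wave h
  have h0 : (fun z => A z * defect p u t (wave z)) = 0 := by
    refine eq_zero_of_waveTransform_eq_zero (hAc.mul hℓ) (hA.integrable_mul_defect h) fun η => ?_
    obtain ⟨C, hC⟩ := (hA.translate η).exists_hasC1Bound
    have h1 := (hA.translate η).defect_eq h
    have hCr : HasC1Bound (fun ξ => K (ξ - η)) (‖Complex.reCLM‖ * C) := by
      simpa using hC.clm_comp Complex.reCLM
    have h2 := defect_clm_comp hCr h Complex.ofRealCLM
    simp only [hK, map_zero, Complex.ofRealCLM_apply] at h2
    rw [h2] at h1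
    rw [waveTransform, h1]
    refine integral_congr_ae (Eventually.of_forall fun z => ?_)
    have : wave η (-z) = wave z (-η) := by
      rw [wave, wave, map_neg, map_neg, pairing_comm]
    simp only [this]
    ring
  have h1 := hℓ.ext_on hAd continuous_zero fun z (hz : A z ≠ 0) =>
    (mul_eq_zero.1 (congrFun h0 z)).resolve_left hz
  exact congrFun h1 z

theorem exists_hasC1Bound_of_mem_rkhs (hA1 : KernelAssumption K) (hA2 : KernelMoment K)
    {φ : SpaceTime d → ℝ} (hφ : φ ∈ rkhs K hA1.posDef) : ∃ C, HasC1Bound φ C := by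
  have : Fact (kernelMatrix K).PosSemidef := ⟨hA1.posDef.posSemidef⟩
  obtain ⟨f, rfl⟩ := hφ
  obtain ⟨-, M, -, -, hf, -⟩ := exists_seq_kernelSpan hA1 hA2 f
  exact ⟨M, hf⟩

theorem defect_eq_zero_of_mem_rkhs (h : IsAdmissible p u t) (hA1 : KernelAssumption K)
    (hA2 : KernelMoment K) (hw : ∀ z : SpaceTime d, defect p u t (wave z) = 0)
    {φ : SpaceTime d → ℝ} (hφ : φ ∈ rkhs K hA1.posDef) : defect p u t φ = 0 := by
  have : Fact (kernelMatrix K).PosSemidef := ⟨hA1.posDef.posSemidef⟩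
  obtain ⟨f, rfl⟩ := hφ
  obtain ⟨F, M, hF, hFM, -, hlim, hlim'⟩ := exists_seq_kernelSpan hA1 hA2 f
  obtain ⟨A, -, -, hA, -⟩ := exists_superposition_kernel hA1 hA2
  refine tendsto_nhds_unique (tendsto_defect h (Eventually.of_forall hFM) hlim hlim')
    (tendsto_const_nhds.congr fun n => ?_)
  obtain ⟨B, hB⟩ := exists_isSuperposition_of_mem_kernelSpan hA (hF n)
  exact (defect_eq_zero_of_isSuperposition h hw (hFM n) hB).symm

theorem translate_mem_rkhs (hA1 : KernelAssumption K) (η : SpaceTime d) :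
    (fun ξ => K (ξ - η)) ∈ rkhs K hA1.posDef := by
  have : Fact (kernelMatrix K).PosSemidef := ⟨hA1.posDef.posSemidef⟩
  exact ⟨RKHS.kerFun _ η 1, funext fun ξ => by simp [kerFun_ofKernel_apply]⟩

end WeakContinuity
end

theorem mainTheorem3 (d : ℕ) (T : ℝ) (hT : 0 < T)
    (K : WeakContinuity.SpaceTime d → ℝ)
    (hA1 : WeakContinuity.KernelAssumption K) (hA2 : WeakContinuity.KernelMoment K)
    (p : WeakContinuity.SpaceTime d → ℝ) (hA3 : WeakContinuity.FlowAssumption T p)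
    (u : WeakContinuity.SpaceTime d → WeakContinuity.Space d)
    (hu : WeakContinuity.IsVelocity T p u)
    (t : ℝ) (ht : t ∈ Set.Icc 0 T) :
    (∀ φ, WeakContinuity.IsTest φ → WeakContinuity.WellDefined p u t φ) ∧
    (∀ φ ∈ WeakContinuity.rkhs K hA1.posDef, WeakContinuity.WellDefined p u t φ) ∧
    ((∀ φ, WeakContinuity.IsTest φ → WeakContinuity.WeakEquation p u t φ) ↔
      ∀ φ ∈ WeakContinuity.rkhs K hA1.posDef, WeakContinuity.WeakEquation p u t φ) := by
  open WeakContinuity in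
  have h : IsAdmissible p u t := isAdmissible hA3 hu ht
  have htest : ∀ φ : SpaceTime d → ℝ, IsTest φ → (WeakEquation p u t φ ↔ defect p u t φ = 0) :=
    fun φ hφ => hφ.hasC1Bound.elim fun _ hC => hC.weakEquation_iff h ht.1
  have hrkhs : ∀ φ ∈ rkhs K hA1.posDef, (WeakEquation p u t φ ↔ defect p u t φ = 0) :=
    fun φ hφ => (exists_hasC1Bound_of_mem_rkhs hA1 hA2 hφ).elim
      fun _ hC => hC.weakEquation_iff h ht.1
  refine ⟨fun φ hφ => hφ.hasC1Bound.elim fun _ hC => hC.wellDefined h,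
    fun φ hφ => (exists_hasC1Bound_of_mem_rkhs hA1 hA2 hφ).elim fun _ hC => hC.wellDefined h,
    fun H φ hφ => ?_, fun H φ hφ => ?_⟩
  · refine (hrkhs φ hφ).2 (defect_eq_zero_of_mem_rkhs h hA1 hA2 ?_ hφ)
    exact defect_wave_eq_zero_of_isTest h fun ψ hψ => (htest ψ hψ).1 (H ψ hψ)
  · obtain ⟨C, hC⟩ := hφ.hasC1Bound
    obtain ⟨A, hA⟩ := hφ.exists_isSuperposition
    refine (htest φ hφ).2 (defect_eq_zero_of_isSuperposition h ?_ hC hA)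
    refine defect_wave_eq_zero_of_translates h hA1 hA2 fun η => ?_
    have hη := translate_mem_rkhs hA1 η
    exact (hrkhs _ hη).1 (H _ hη)
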